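/- Proposition 2.7 (Worst-case expectation function). Let $p\ge 1$ be an integer and $\rho>0$. For a positive semidefinite matrix $\widehat\Sigma\in\mathbb S_+^p$ (the real symmetric positive semidefinite $p\times p$ matrices) and a positive definite matrix $X\in\mathbb S_{++}^p$, let $$\mathcal P_\rho^0(\widehat\Sigma)=\{\mathcal N(0,S): S\in\mathbb S_+^p,\ \mathbb W(\mathcal N(0,S),\mathcal N(0,\widehat\Sigma))\le\rho\},$$ where singular covariance matrices are allowed and $\mathbb W(\mathbb P_1,\mathbb P_2)=\inf_\pi\big(\int_{\mathbb R^p\times\mathbb R^p}\|\xi_1-\xi_2\|^2\,\pi(d\xi_1,d\xi_2)\big)^{1/2}$ is the type-2 Wasserstein distance, the infimum being over all joint distributions $\pi$ with marginals $\mathbb P_1,\mathbb P_2$ and $\|\cdot\|$ being the Euclidean norm. Define the worst-case expectation $$g(\widehat\Sigma,X)=\sup_{\mathbb Q\in\mathcal P_\rho^0(\widehat\Sigma)}\mathbb E^{\mathbb Q}[\xi^\top X\xi].$$ Then, for all $\widehat\Sigma\in\mathbb S_+^p$ and $X\in\mathbb S_{++}^p$, all these expectations exist, $g(\widehat\Sigma,X)$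 is finite, and $$g(\widehat\Sigma,X)=\inf_{\gamma\in\mathbb R}\big\{\gamma(\rho^2-\operatorname{Tr}\widehat\Sigma)+\gamma^2\langle(\gamma I-X)^{-1},\widehat\Sigma\rangle : \gamma I\succ X\big\},$$ where $\langle A,B\rangle=\operatorname{Tr}(A^\top B)$, and $A\succ B$ means that $A-B$ is positive definite. Moreover, $g$ is (jointly) continuous in $(\widehat\Sigma,X)\in\mathbb S_+^p\times\mathbb S_{++}^p$. -/

import Mathlib

open MeasureTheory ProbabilityTheory Matrix
open scoped ENNReal

noncomputable section

/-- `π` is a joint distribution on `ℝ^p × ℝ^p` with marginals `P₁` and `P₂`. -/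
def IsCoupling {p : ℕ} (P₁ P₂ : Measure (EuclideanSpace ℝ (Fin p)))
    (π : Measure (EuclideanSpace ℝ (Fin p) × EuclideanSpace ℝ (Fin p))) : Prop :=
  π.map Prod.fst = P₁ ∧ π.map Prod.snd = P₂

/-- The type-2 Wasserstein distance with respect to the Euclidean norm, with values in `[0, ∞]`:
the infimum of `(∫ ‖ξ₁ - ξ₂‖² dπ)^(1/2)` over all couplings `π`. -/
def wasserstein {p : ℕ} (P₁ P₂ : Measure (EuclideanSpace ℝ (Fin p))) : ℝ≥0∞ :=
  ⨅ (π : Measure (EuclideanSpace ℝ (Fin p) × EuclideanSpace ℝ (Fin p)))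
    (_ : IsCoupling P₁ P₂ π), (∫⁻ z, ‖z.1 - z.2‖ₑ ^ 2 ∂π) ^ (1 / 2 : ℝ)

/-- The normal distributions on `ℝ^p` with zero mean and an arbitrary, possibly singular,
positive semidefinite covariance matrix. -/
def zeroMeanNormals (p : ℕ) : Set (Measure (EuclideanSpace ℝ (Fin p))) :=
  {Q | ∃ S : Matrix (Fin p) (Fin p) ℝ, S.PosSemidef ∧ Q = multivariateGaussian 0 S}

/-- The ambiguity set: all zero-mean normal distributions whose Wasserstein distance from
`N(0, Shat)` is at most `ρ`. -/
def ambiguitySet {p : ℕ} (ρ : ℝ) (Shat : Matrix (Fin p) (Fin p) ℝ) :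
    Set (Measure (EuclideanSpace ℝ (Fin p))) :=
  {Q | Q ∈ zeroMeanNormals p ∧
    wasserstein Q (multivariateGaussian 0 Shat) ≤ ENNReal.ofReal ρ}

/-- The quadratic form `ξᵀ X ξ = ⟨ξ ξᵀ, X⟩`. -/
def quadForm {p : ℕ} (X : Matrix (Fin p) (Fin p) ℝ) (ξ : EuclideanSpace ℝ (Fin p)) : ℝ :=
  ξ.ofLp ⬝ᵥ (X *ᵥ ξ.ofLp)

/-- The expectations `E_Q[ξᵀ X ξ]` as `Q` ranges over the ambiguity set. -/
def expectationValues {p : ℕ} (ρ : ℝ) (Shat X : Matrix (Fin p) (Fin p) ℝ) : Set ℝ :=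
  (fun Q => ∫ ξ, quadForm X ξ ∂Q) '' ambiguitySet ρ Shat

/-- The worst-case expectation function `g(Shat, X)`. -/
def worstCaseExpectation {p : ℕ} (ρ : ℝ) (Shat X : Matrix (Fin p) (Fin p) ℝ) : ℝ :=
  sSup (expectationValues ρ Shat X)

/-- The trace inner product `⟨A, B⟩ = Tr(Aᵀ B)`. -/
def traceInner {p : ℕ} (A B : Matrix (Fin p) (Fin p) ℝ) : ℝ :=
  (Aᵀ * B).trace

/-- The objective `γ (ρ² - Tr Shat) + γ² ⟨(γ I - X)⁻¹, Shat⟩`. -/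
def dualObjective {p : ℕ} (ρ : ℝ) (Shat X : Matrix (Fin p) (Fin p) ℝ) (γ : ℝ) : ℝ :=
  γ * (ρ ^ 2 - Shat.trace) + γ ^ 2 * traceInner (γ • (1 : Matrix (Fin p) (Fin p) ℝ) - X)⁻¹ Shat

/-- The real numbers `γ` with `γ I ≻ X`. -/
def dualFeasible {p : ℕ} (X : Matrix (Fin p) (Fin p) ℝ) : Set ℝ :=
  {γ | (γ • (1 : Matrix (Fin p) (Fin p) ℝ) - X).PosDef}

end

/-! ### Gaussian second moments and the coupling bound -/

section GaussianMoments

open scoped MatrixOrder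

variable {p : ℕ}

/-! Everything reduces to maximizing `Tr(Aᵀ X A)` over the Frobenius ball of radius `ρ` around `R =
S^(1/2)`. Pushing one standard Gaussian through `A` and `R` couples `N(0, AAᵀ)` with `N(0, S)` at
squared cost `‖A - R‖²`, so this maximum is at most `g` (`trace_mem_expectationValues`). Completing
a square pointwise and integrating over any coupling bounds `g` by every dual value
(`integral_le_dualObjective`). The gap closes as in a trust-region problem: the Lagrangian maximizer
is `γ(γI - X)⁻¹R`, and either some `γ` places it on the sphere of radius `ρ`, or `γ` tends to the
top eigenvalue of `X` and the unused budget is spent along a top eigenvector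
(`exists_displacement_le`, `exists_perturbation_ge`). Continuity follows because the maximum runs
over a fixed compact set of displacements and `S ↦ S^(1/2)` is continuous. -/

lemma memLp_coord {μ : Measure (EuclideanSpace ℝ (Fin p))} [IsGaussian μ] (i : Fin p) :
    MemLp (fun ξ : EuclideanSpace ℝ (Fin p) => ξ i) 2 μ :=
  IsGaussian.memLp_two_id.continuousLinearMap_comp (EuclideanSpace.proj (𝕜 := ℝ) i)

lemma quadForm_eq_sum (X : Matrix (Fin p) (Fin p) ℝ) (ξ : EuclideanSpace ℝ (Fin p)) :
    quadForm X ξ = ∑ i, ∑ j, X i j * (ξ i * ξ j) := by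
  simp only [quadForm, dotProduct, mulVec, Finset.mul_sum]
  exact Finset.sum_congr rfl fun i _ => Finset.sum_congr rfl fun j _ => by ring

lemma integrable_quadForm {μ : Measure (EuclideanSpace ℝ (Fin p))} [IsGaussian μ]
    (X : Matrix (Fin p) (Fin p) ℝ) : Integrable (quadForm X) μ := by
  rw [funext (quadForm_eq_sum X)]
  exact integrable_finsetSum _ fun i _ => integrable_finsetSum _ fun j _ =>
    ((memLp_coord i).integrable_mul (memLp_coord j)).const_mul _

lemma integral_coord_mul_coord_stdGaussian (i j : Fin p) :
    ∫ ξ : EuclideanSpace ℝ (Fin p), ξ i * ξ j ∂(stdGaussian (EuclideanSpace ℝ (Fin p))) =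
      (1 : Matrix (Fin p) (Fin p) ℝ) i j := by
  have h := covariance_eval_multivariateGaussian (μ := (0 : EuclideanSpace ℝ (Fin p)))
    (PosSemidef.one (n := Fin p) (R := ℝ)) i j
  rw [multivariateGaussian_zero_one] at h
  have h0 (k : Fin p) :
      ∫ ξ : EuclideanSpace ℝ (Fin p), ξ k ∂(stdGaussian (EuclideanSpace ℝ (Fin p))) = 0 :=
    integral_strongDual_stdGaussian (EuclideanSpace.proj k)
  rw [covariance_eq_sub (memLp_coord i) (memLp_coord j), h0, h0] at h
  simpa using h

lemma integral_quadForm_stdGaussian (X : Matrix (Fin p) (Fin p) ℝ) :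
    ∫ ξ, quadForm X ξ ∂(stdGaussian (EuclideanSpace ℝ (Fin p))) = X.trace := by
  have hint (i j : Fin p) : Integrable (fun ξ : EuclideanSpace ℝ (Fin p) => X i j * (ξ i * ξ j))
      (stdGaussian (EuclideanSpace ℝ (Fin p))) :=
    ((memLp_coord i).integrable_mul (memLp_coord j)).const_mul _
  simp_rw [quadForm_eq_sum]
  rw [integral_finsetSum _ fun i _ => integrable_finsetSum _ fun j _ => hint i j]
  simp_rw [integral_finsetSum _ fun j _ => hint _ j, integral_const_mul,
    integral_coord_mul_coord_stdGaussian]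
  simp [Matrix.one_apply, Matrix.trace]

lemma quadForm_toEuclideanCLM (A X : Matrix (Fin p) (Fin p) ℝ) (ξ : EuclideanSpace ℝ (Fin p)) :
    quadForm X (toEuclideanCLM (𝕜 := ℝ) A ξ) = quadForm (Aᵀ * X * A) ξ := by
  simp only [quadForm, ofLp_toEuclideanCLM]
  rw [← mulVec_mulVec, ← mulVec_mulVec, dotProduct_mulVec (ξ.ofLp), vecMul_transpose]

lemma integral_quadForm_map (A X : Matrix (Fin p) (Fin p) ℝ) :
    ∫ ξ, quadForm X ξ ∂((stdGaussian (EuclideanSpace ℝ (Fin p))).map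
      (toEuclideanCLM (𝕜 := ℝ) A)) = (Aᵀ * X * A).trace := by
  rw [integral_map (by fun_prop) (integrable_quadForm X).aestronglyMeasurable]
  simp_rw [quadForm_toEuclideanCLM, integral_quadForm_stdGaussian]

lemma multivariateGaussian_zero_eq_map (S : Matrix (Fin p) (Fin p) ℝ) :
    multivariateGaussian 0 S = (stdGaussian (EuclideanSpace ℝ (Fin p))).map
      (toEuclideanCLM (𝕜 := ℝ) (CFC.sqrt S)) := by
  simp [multivariateGaussian]

lemma posSemidef_mul_transpose_self (A : Matrix (Fin p) (Fin p) ℝ) : (A * Aᵀ).PosSemidef := by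
  simpa using posSemidef_self_mul_conjTranspose A

/-- Gaussian laws are determined by mean and covariance. `A` need not be symmetric, so the whole
Frobenius ball of factors is available. -/
lemma map_stdGaussian_eq_multivariateGaussian (A : Matrix (Fin p) (Fin p) ℝ) :
    (stdGaussian (EuclideanSpace ℝ (Fin p))).map (toEuclideanCLM (𝕜 := ℝ) A) =
      multivariateGaussian 0 (A * Aᵀ) := by
  apply IsGaussian.ext
  · simp only [id_eq, integral_id_multivariateGaussian]
    rw [ContinuousLinearMap.integral_id_map IsGaussian.integrable_id, integral_id_stdGaussian,
      map_zero]
  · have hadj : (toEuclideanCLM (𝕜 := ℝ) A).adjoint = toEuclideanCLM (𝕜 := ℝ) Aᵀ := by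
      rw [← conjTranspose_eq_transpose_of_trivial]
      exact ((toEuclideanCLM (n := Fin p) (𝕜 := ℝ)).map_star' A).symm
    ext x y
    rw [covarianceBilin_multivariateGaussian (posSemidef_mul_transpose_self A),
      covarianceBilin_map IsGaussian.memLp_two_id, covarianceBilin_stdGaussian, innerSL_apply_apply,
      ContinuousLinearMap.adjoint_inner_left, hadj,
      ← ContinuousLinearMap.comp_apply, ← ContinuousLinearMap.mul_def, ← map_mul,
      inner_toEuclideanCLM]

lemma norm_sq_eq_quadForm (ξ : EuclideanSpace ℝ (Fin p)) : ‖ξ‖ ^ 2 = quadForm 1 ξ := by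
  rw [EuclideanSpace.real_norm_sq_eq, quadForm, one_mulVec, dotProduct]
  exact Finset.sum_congr rfl fun i _ => by ring

lemma transpose_sqrt (S : Matrix (Fin p) (Fin p) ℝ) : (CFC.sqrt S)ᵀ = CFC.sqrt S := by
  simpa using (CFC.sqrt_nonneg S).posSemidef.isHermitian.eq

lemma sqrt_mul_sqrt {S : Matrix (Fin p) (Fin p) ℝ} (hS : S.PosSemidef) :
    CFC.sqrt S * CFC.sqrt S = S := CFC.sqrt_mul_sqrt_self _ hS.nonneg

lemma integral_quadForm_multivariateGaussian {S : Matrix (Fin p) (Fin p) ℝ} (hS : S.PosSemidef)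
    (X : Matrix (Fin p) (Fin p) ℝ) :
    ∫ ξ, quadForm X ξ ∂(multivariateGaussian 0 S) = (X * S).trace := by
  rw [multivariateGaussian_zero_eq_map, integral_quadForm_map, transpose_sqrt, mul_assoc,
    trace_mul_comm, mul_assoc, sqrt_mul_sqrt hS]

lemma integral_norm_sq_toEuclideanCLM (A : Matrix (Fin p) (Fin p) ℝ) :
    ∫⁻ ξ, ‖toEuclideanCLM (𝕜 := ℝ) A ξ‖ₑ ^ 2 ∂(stdGaussian (EuclideanSpace ℝ (Fin p))) =
      ENNReal.ofReal (Aᵀ * A).trace := by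
  have h := integral_quadForm_stdGaussian (Aᵀ * 1 * A)
  simp_rw [← quadForm_toEuclideanCLM, ← norm_sq_eq_quadForm] at h
  rw [mul_one] at h
  rw [← h, ofReal_integral_eq_lintegral_ofReal]
  · simp [ENNReal.ofReal_pow]
  · simp_rw [norm_sq_eq_quadForm, quadForm_toEuclideanCLM]
    exact integrable_quadForm _
  · exact Filter.Eventually.of_forall fun _ => by positivity

/-- One explicit coupling suffices here, so no closed formula for the Gaussian Wasserstein distance
is needed. -/
lemma trace_mem_expectationValues {ρ : ℝ} (hρ : 0 < ρ) (S X A : Matrix (Fin p) (Fin p) ℝ)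
    (hA : ((A - CFC.sqrt S)ᵀ * (A - CFC.sqrt S)).trace ≤ ρ ^ 2) :
    (Aᵀ * X * A).trace ∈ expectationValues ρ S X := by
  refine ⟨_, ⟨⟨A * Aᵀ, posSemidef_mul_transpose_self A,
    map_stdGaussian_eq_multivariateGaussian A⟩, ?_⟩, integral_quadForm_map A X⟩
  let F : EuclideanSpace ℝ (Fin p) → EuclideanSpace ℝ (Fin p) × EuclideanSpace ℝ (Fin p) :=
    fun ξ => (toEuclideanCLM (𝕜 := ℝ) A ξ, toEuclideanCLM (𝕜 := ℝ) (CFC.sqrt S) ξ)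
  have hF : Measurable F := by fun_prop
  have hπ : IsCoupling ((stdGaussian _).map (toEuclideanCLM (𝕜 := ℝ) A)) (multivariateGaussian 0 S)
      ((stdGaussian _).map F) := by
    constructor
    · rw [Measure.map_map measurable_fst hF]; rfl
    · rw [Measure.map_map measurable_snd hF, multivariateGaussian_zero_eq_map]; rfl
  refine (iInf₂_le ((stdGaussian _).map F)  hπ).trans ?_
  rw [lintegral_map (by fun_prop) hF]
  have h : ∀ ξ, (F ξ).1 - (F ξ).2 = toEuclideanCLM (𝕜 := ℝ) (A - CFC.sqrt S) ξ := by
    intro ξ; simp [F]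
  simp_rw [h, integral_norm_sq_toEuclideanCLM]
  calc _ ≤ (ENNReal.ofReal (ρ ^ 2)) ^ (1 / 2 : ℝ) := by gcongr
    _ = ENNReal.ofReal ρ := by
      rw [ENNReal.ofReal_rpow_of_nonneg (by positivity) (by positivity), ← Real.sqrt_eq_rpow,
        Real.sqrt_sq hρ.le]

end GaussianMoments

/-! ### Weak duality -/

section WeakDuality

variable {p : ℕ}

/-- The Lagrangian in `A` is stationary at `γNR`. Rectangular `A`, `R` serve both single vectors
(columns) and matrix factors. -/
lemma trace_quadratic_complete_square {m n : Type*} [Fintype m] [DecidableEq m] [Fintype n]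
    (X N : Matrix m m ℝ) (γ : ℝ) (hX : Xᵀ = X) (hN : (γ • (1 : Matrix m m ℝ) - X) * N = 1)
    (A R : Matrix m n ℝ) :
    (Aᵀ * X * A).trace = γ * ((A - R)ᵀ * (A - R)).trace - γ * (Rᵀ * R).trace
      + γ ^ 2 * (Rᵀ * N * R).trace
      - ((A - γ • (N * R))ᵀ * (γ • (1 : Matrix m m ℝ) - X) * (A - γ • (N * R))).trace := by
  set M := γ • (1 : Matrix m m ℝ) - X with hM
  have hMt : Mᵀ = M := by simp [hM, hX]
  have hXM : X = γ • 1 - M := by simp [hM]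
  have hNt : Nᵀ * M = 1 := by
    have := congrArg transpose hN
    simpa [transpose_mul, hMt] using this
  have e1 : (A - γ • (N * R))ᵀ * M * (A - γ • (N * R)) =
      Aᵀ * M * A - γ • (Aᵀ * R) - γ • (Rᵀ * A) + γ ^ 2 • (Rᵀ * N * R) := by
    have i1 : Aᵀ * M * (N * R) = Aᵀ * R := by
      rw [Matrix.mul_assoc, ← Matrix.mul_assoc M, hN, Matrix.one_mul]
    have i2 : (N * R)ᵀ * M * A = Rᵀ * A := by
      rw [transpose_mul, Matrix.mul_assoc Rᵀ, hNt, Matrix.mul_one]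
    have i3 : (N * R)ᵀ * M * (N * R) = Rᵀ * N * R := by
      rw [transpose_mul, Matrix.mul_assoc Rᵀ, hNt, Matrix.mul_one, Matrix.mul_assoc]
    simp only [transpose_sub, transpose_smul, Matrix.sub_mul, Matrix.mul_sub, Matrix.smul_mul,
      Matrix.mul_smul, i1, i2, i3, smul_sub, smul_smul, pow_two]
    abel
  have e2 : (Rᵀ * A).trace = (Aᵀ * R).trace := by
    rw [← trace_transpose, transpose_mul, transpose_transpose]
  rw [e1, hXM]
  simp only [transpose_sub, Matrix.sub_mul, Matrix.mul_sub, Matrix.smul_mul,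
      Matrix.mul_smul, trace_sub, trace_add, trace_smul, smul_eq_mul, Matrix.mul_one, e2]
  ring

lemma quadForm_eq_trace (X : Matrix (Fin p) (Fin p) ℝ) (ξ : EuclideanSpace ℝ (Fin p)) :
    quadForm X ξ = ((replicateCol Unit ξ.ofLp)ᵀ * X * replicateCol Unit ξ.ofLp).trace := by
  rw [Matrix.mul_assoc, ← replicateCol_mulVec, transpose_replicateCol]
  simp [quadForm, Matrix.trace, replicateRow_mul_replicateCol_apply]

lemma dualFeasible_pos (hp : 0 < p) {X : Matrix (Fin p) (Fin p) ℝ} (hX : X.PosDef) {γ : ℝ}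
    (hγ : γ ∈ dualFeasible X) : 0 < γ := by
  have h : (γ • (1 : Matrix (Fin p) (Fin p) ℝ)).PosDef := by simpa using Matrix.PosDef.add hγ hX
  simpa using h.diag_pos (i := ⟨0, hp⟩)

lemma quadForm_le {X : Matrix (Fin p) (Fin p) ℝ} (hX : X.PosDef) {γ : ℝ}
    (hγ : γ ∈ dualFeasible X) (ξ η : EuclideanSpace ℝ (Fin p)) :
    quadForm X ξ ≤ γ * ‖ξ - η‖ ^ 2 - γ * quadForm 1 η
      + γ ^ 2 * quadForm (γ • (1 : Matrix (Fin p) (Fin p) ℝ) - X)⁻¹ η := by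
  have hM : (γ • (1 : Matrix (Fin p) (Fin p) ℝ) - X).PosDef := hγ
  have h := trace_quadratic_complete_square X _ γ (by simpa using hX.isHermitian.eq)
    (mul_nonsing_inv _ ((isUnit_iff_isUnit_det _).mp hM.isUnit))
    (replicateCol Unit ξ.ofLp) (replicateCol Unit η.ofLp)
  have h2 := (hM.posSemidef.conjTranspose_mul_mul_same (replicateCol Unit ξ.ofLp -
    γ • ((γ • (1 : Matrix (Fin p) (Fin p) ℝ) - X)⁻¹ * replicateCol Unit η.ofLp))).trace_nonneg
  rw [conjTranspose_eq_transpose_of_trivial] at h2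
  have h3 : replicateCol Unit ξ.ofLp - replicateCol Unit η.ofLp =
    replicateCol Unit (ξ - η).ofLp := rfl
  rw [norm_sq_eq_quadForm, quadForm_eq_trace, h, quadForm_eq_trace, quadForm_eq_trace,
    quadForm_eq_trace, Matrix.mul_one, Matrix.mul_one, h3]
  linarith

lemma integral_le_dualObjective (hp : 0 < p) {ρ : ℝ} (hρ : 0 < ρ)
    {S X : Matrix (Fin p) (Fin p) ℝ} (hS : S.PosSemidef) (hX : X.PosDef)
    {Q : Measure (EuclideanSpace ℝ (Fin p))} (hQ : Q ∈ ambiguitySet ρ S) {γ : ℝ}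
    (hγ : γ ∈ dualFeasible X) : ∫ ξ, quadForm X ξ ∂Q ≤ dualObjective ρ S X γ := by
  obtain ⟨⟨S', hS', rfl⟩, hW⟩ := hQ
  have hγ0 := dualFeasible_pos hp hX hγ
  have hM : (γ • (1 : Matrix (Fin p) (Fin p) ℝ) - X).PosDef := hγ
  set N := (γ • (1 : Matrix (Fin p) (Fin p) ℝ) - X)⁻¹ with hN
  have hNt : Nᵀ = N := by simpa using hM.inv.isHermitian.eq
  set E := ∫ ξ, quadForm X ξ ∂(multivariateGaussian 0 S')
  -- `K` is the squared cost that duality forces on every coupling; if it is negative, `√K = 0` and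
  -- the bound is harmless.
  set K := (E + γ * S.trace - γ ^ 2 * traceInner N S) / γ with hK
  suffices h : √K ≤ ρ by
    have h2 : K ≤ ρ ^ 2 := (Real.sqrt_le_left hρ.le).mp h
    rw [hK, div_le_iff₀ hγ0] at h2
    simp only [dualObjective, ← hN]
    linarith
  rw [← ENNReal.ofReal_le_ofReal_iff hρ.le]
  refine le_trans (le_iInf₂ fun π hπ => ?_) hW
  have hfst : MemLp (fun z : EuclideanSpace ℝ (Fin p) × EuclideanSpace ℝ (Fin p) => z.1) 2 π := by
    have : MemLp id 2 (π.map Prod.fst) := by rw [hπ.1]; exact IsGaussian.memLp_two_id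
    exact this.comp_of_map (by fun_prop)
  have hsnd : MemLp (fun z : EuclideanSpace ℝ (Fin p) × EuclideanSpace ℝ (Fin p) => z.2) 2 π := by
    have : MemLp id 2 (π.map Prod.snd) := by rw [hπ.2]; exact IsGaussian.memLp_two_id
    exact this.comp_of_map (by fun_prop)
  have hint : Integrable (fun z : EuclideanSpace ℝ (Fin p) × EuclideanSpace ℝ (Fin p) =>
      ‖z.1 - z.2‖ ^ 2) π := (hfst.sub hsnd).integrable_norm_pow (by norm_num)
  have hq1 (Y : Matrix (Fin p) (Fin p) ℝ) : Integrable (fun z => quadForm Y z.1) π := by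
    have : Integrable (quadForm Y) (π.map Prod.fst) := by rw [hπ.1]; exact integrable_quadForm Y
    exact this.comp_measurable measurable_fst
  have hq2 (Y : Matrix (Fin p) (Fin p) ℝ) : Integrable (fun z => quadForm Y z.2) π := by
    have : Integrable (quadForm Y) (π.map Prod.snd) := by rw [hπ.2]; exact integrable_quadForm Y
    exact this.comp_measurable measurable_snd
  have hi2 (Y : Matrix (Fin p) (Fin p) ℝ) : ∫ z, quadForm Y z.2 ∂π = (Y * S).trace := by
    rw [← integral_quadForm_multivariateGaussian hS, ← hπ.2, integral_map (by fun_prop)]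
    rw [hπ.2]; exact (integrable_quadForm Y).aestronglyMeasurable
  have hi1 : ∫ z, quadForm X z.1 ∂π = E := by
    simp only [E]
    rw [← hπ.1, integral_map (by fun_prop)]
    rw [hπ.1]; exact (integrable_quadForm X).aestronglyMeasurable
  have hmono := integral_mono (hq1 X)
    (((hint.const_mul γ).sub ((hq2 1).const_mul γ)).add ((hq2 N).const_mul (γ ^ 2)))
    (fun z => quadForm_le hX hγ z.1 z.2)
  simp only [Pi.add_apply, Pi.sub_apply] at hmono
  rw [integral_add (by exact (hint.const_mul γ).sub ((hq2 1).const_mul γ))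
    ((hq2 N).const_mul (γ ^ 2)), integral_sub (hint.const_mul γ) ((hq2 1).const_mul γ),
    integral_const_mul, integral_const_mul, integral_const_mul, hi1, hi2, hi2, one_mul] at hmono
  have hKle : K ≤ ∫ z, ‖z.1 - z.2‖ ^ 2 ∂π := by
    rw [hK, div_le_iff₀ hγ0, traceInner, hNt]
    linarith
  have hlin : ∫⁻ z, ‖z.1 - z.2‖ₑ ^ 2 ∂π = ENNReal.ofReal (∫ z, ‖z.1 - z.2‖ ^ 2 ∂π) := by
    rw [ofReal_integral_eq_lintegral_ofReal hint
      (Filter.Eventually.of_forall fun _ => by positivity)]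
    simp [ENNReal.ofReal_pow]
  rw [hlin, ENNReal.ofReal_rpow_of_nonneg (integral_nonneg fun _ => by positivity) (by norm_num),
    ← Real.sqrt_eq_rpow]
  exact ENNReal.ofReal_le_ofReal (Real.sqrt_le_sqrt hKle)

end WeakDuality

/-! ### Strong duality -/

section StrongDuality

open scoped MatrixOrder

variable {p : ℕ}

lemma exists_maximal_rayleigh (hp : 0 < p) (X : Matrix (Fin p) (Fin p) ℝ) :
    ∃ (v : Fin p → ℝ) (l : ℝ), v ⬝ᵥ v = 1 ∧ v ⬝ᵥ X *ᵥ v = l ∧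
      ∀ x, x ⬝ᵥ X *ᵥ x ≤ l * (x ⬝ᵥ x) := by
  have : Nonempty (Fin p) := ⟨⟨0, hp⟩⟩
  have hdot (x : EuclideanSpace ℝ (Fin p)) : x.ofLp ⬝ᵥ x.ofLp = ‖x‖ ^ 2 := by
    rw [norm_sq_eq_quadForm, quadForm, one_mulVec]
  have hcont : Continuous (quadForm X) := by
    rw [funext (quadForm_eq_sum X)]
    fun_prop
  obtain ⟨v, hv, hmax⟩ := (isCompact_sphere (0 : EuclideanSpace ℝ (Fin p)) 1).exists_isMaxOn
    (NormedSpace.sphere_nonempty.mpr zero_le_one) hcont.continuousOn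
  refine ⟨v.ofLp, _, ?_, rfl, fun x => ?_⟩
  · rw [hdot, mem_sphere_zero_iff_norm.mp hv, one_pow]
  rcases eq_or_ne x 0 with rfl | hx
  · simp
  set y : EuclideanSpace ℝ (Fin p) := WithLp.toLp 2 x with hy
  have hy0 : 0 < ‖y‖ := norm_pos_iff.mpr (by simpa [hy] using hx)
  have h := hmax (show ‖y‖⁻¹ • y ∈ Metric.sphere 0 1 by simp [norm_smul, hy0.ne'])
  have hxy : x ⬝ᵥ x = ‖y‖ ^ 2 := hdot y
  have h2 : quadForm X (‖y‖⁻¹ • y) = (x ⬝ᵥ X *ᵥ x) / ‖y‖ ^ 2 := by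
    simp only [quadForm, hy, WithLp.ofLp_smul, mulVec_smul, dotProduct_smul, smul_dotProduct,
      smul_eq_mul]
    field_simp
  rw [Set.mem_ofPred_eq, h2, div_le_iff₀ (by positivity)] at h
  rw [hxy]
  exact h

/-- Two coefficients cover both `γI - X` and its rescaling `I - tX` with `t = 1/γ`. -/
lemma posDef_smul_one_sub_smul {X : Matrix (Fin p) (Fin p) ℝ} (hX : X.PosDef) {l a b : ℝ}
    (hl : ∀ x, x ⬝ᵥ X *ᵥ x ≤ l * (x ⬝ᵥ x)) (hb : 0 ≤ b) (hab : b * l < a) :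
    (a • (1 : Matrix (Fin p) (Fin p) ℝ) - b • X).PosDef := by
  refine PosDef.of_dotProduct_mulVec_pos ?_ fun x hx => ?_
  · have := hX.isHermitian.eq
    simp only [IsHermitian, conjTranspose_sub, conjTranspose_smul, this]
    simp
  · have hx0 : 0 < x ⬝ᵥ x := by
      simpa using dotProduct_star_self_pos_iff.mpr hx
    have h1 := mul_le_mul_of_nonneg_left (hl x) hb
    simp only [star_trivial, sub_mulVec, smul_mulVec, one_mulVec, dotProduct_sub, dotProduct_smul,
      smul_eq_mul]
    nlinarith

lemma lt_of_mem_dualFeasible {X : Matrix (Fin p) (Fin p) ℝ} {v : Fin p → ℝ} {γ : ℝ}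
    (hv : v ⬝ᵥ v = 1) (hγ : γ ∈ dualFeasible X) : v ⬝ᵥ X *ᵥ v < γ := by
  have hv0 : v ≠ 0 := by rintro rfl; simp at hv
  have h := Matrix.PosDef.dotProduct_mulVec_pos hγ hv0
  simp only [star_trivial, sub_mulVec, smul_mulVec, one_mulVec, dotProduct_sub, dotProduct_smul,
    smul_eq_mul, hv] at h
  linarith

/-- The squared Frobenius norm of the displacement `(γ(γI - X)⁻¹ - I) S^(1/2)`. -/
noncomputable def displacement (S X : Matrix (Fin p) (Fin p) ℝ) (γ : ℝ) : ℝ :=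
  ((γ • ((γ • (1 : Matrix (Fin p) (Fin p) ℝ) - X)⁻¹ * CFC.sqrt S) - CFC.sqrt S)ᵀ *
    (γ • ((γ • (1 : Matrix (Fin p) (Fin p) ℝ) - X)⁻¹ * CFC.sqrt S) - CFC.sqrt S)).trace

lemma trace_transpose_mul_self_nonneg (A : Matrix (Fin p) (Fin p) ℝ) : 0 ≤ (Aᵀ * A).trace := by
  simpa using (posSemidef_conjTranspose_mul_self A).trace_nonneg

/-- Take the root with the sign of `b`: then `cb ≥ 0`, which gives the bound. -/
lemma exists_root_sq_le {b d : ℝ} (hd : 0 ≤ d) : ∃ c : ℝ, c ^ 2 + 2 * c * b = d ∧ c ^ 2 ≤ d := by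
  have hs : √(b ^ 2 + d) ^ 2 = b ^ 2 + d := Real.sq_sqrt (by positivity)
  have h1 : |b| ≤ √(b ^ 2 + d) := Real.abs_le_sqrt (by linarith)
  rcases le_total 0 b with hb | hb
  · rw [abs_of_nonneg hb] at h1
    exact ⟨-b + √(b ^ 2 + d), by nlinarith, by nlinarith⟩
  · rw [abs_of_nonpos hb] at h1
    exact ⟨-b - √(b ^ 2 + d), by nlinarith, by nlinarith⟩

/-- Adding `c • vvᵀ` to the Lagrangian displacement exhausts the budget; the completed square then
loses only `c²(γ - vᵀXv)`. -/
lemma exists_perturbation_ge {ρ : ℝ} {S X : Matrix (Fin p) (Fin p) ℝ} (hS : S.PosSemidef)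
    (hX : X.PosDef) {v : Fin p → ℝ} (hv : v ⬝ᵥ v = 1) {γ : ℝ} (hγ : γ ∈ dualFeasible X)
    (hle : displacement S X γ ≤ ρ ^ 2) :
    ∃ D : Matrix (Fin p) (Fin p) ℝ, (Dᵀ * D).trace ≤ ρ ^ 2 ∧
      dualObjective ρ S X γ - (ρ ^ 2 - displacement S X γ) * (γ - v ⬝ᵥ X *ᵥ v) ≤
        ((CFC.sqrt S + D)ᵀ * X * (CFC.sqrt S + D)).trace := by
  have hM : (γ • (1 : Matrix (Fin p) (Fin p) ℝ) - X).PosDef := hγ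
  have hMN := mul_nonsing_inv _ ((isUnit_iff_isUnit_det _).mp hM.isUnit)
  have hlt := lt_of_mem_dualFeasible hv hγ
  have hNt : ((γ • (1 : Matrix (Fin p) (Fin p) ℝ) - X)⁻¹)ᵀ =
    (γ • (1 : Matrix (Fin p) (Fin p) ℝ) - X)⁻¹ := by simpa using hM.inv.isHermitian.eq
  set N := (γ • (1 : Matrix (Fin p) (Fin p) ℝ) - X)⁻¹ with hN
  set R := CFC.sqrt S with hR
  have hRt : Rᵀ = R := transpose_sqrt S
  have hRR : R * R = S := sqrt_mul_sqrt hS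
  set Y := γ • (N * R) - R with hY
  have hdisp : displacement S X γ = (Yᵀ * Y).trace := rfl
  set P := vecMulVec v v with hP
  have hPt : Pᵀ = P := by simp [hP, transpose_vecMulVec]
  have hPP : P * P = P := by simp [hP, vecMulVec_mul_vecMulVec, hv]
  have hPtr : P.trace = 1 := by rw [hP, trace_vecMulVec, hv]
  have hPMP : (P * (γ • (1 : Matrix (Fin p) (Fin p) ℝ) - X) * P).trace = γ - v ⬝ᵥ X *ᵥ v := by
    rw [trace_mul_comm, ← mul_assoc, hPP, hP, trace_mul_comm, mul_vecMulVec, trace_vecMulVec,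
      dotProduct_comm]
    simp only [sub_mulVec, smul_mulVec, one_mulVec, dotProduct_sub, dotProduct_smul,
      smul_eq_mul, hv, mul_one]
  -- Since `‖P‖ = 1`, this equation for `c` says `‖Y + cP‖² = ρ²`.
  obtain ⟨c, hc, hc2⟩ := exists_root_sq_le (b := (Yᵀ * P).trace)
    (show 0 ≤ ρ ^ 2 - (Yᵀ * Y).trace by linarith)
  have hYP : (P * Y).trace = (Yᵀ * P).trace := by
    rw [← trace_transpose, transpose_mul, hPt]
  have hD : ((Y + c • P)ᵀ * (Y + c • P)).trace = ρ ^ 2 := by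
    simp only [transpose_add, transpose_smul, hPt, Matrix.add_mul, Matrix.mul_add, Matrix.smul_mul,
      Matrix.mul_smul, trace_add, trace_smul, smul_eq_mul, hPP, hPtr, hYP]
    linarith
  refine ⟨Y + c • P, hD.le, ?_⟩
  have h := trace_quadratic_complete_square X N γ (by simpa using hX.isHermitian.eq) hMN
    (R + (Y + c • P)) R
  have e1 : R + (Y + c • P) - R = Y + c • P := by abel
  have e2 : R + (Y + c • P) - γ • (N * R) = c • P := by rw [hY]; abel
  have e3 : (Rᵀ * N * R).trace = traceInner N S := by
    rw [traceInner, hNt, hRt, trace_mul_comm, ← mul_assoc, hRR, trace_mul_comm]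
  have e4 : ((c • P)ᵀ * (γ • (1 : Matrix (Fin p) (Fin p) ℝ) - X) * (c • P)).trace =
      c ^ 2 * (γ - v ⬝ᵥ X *ᵥ v) := by
    rw [← hPMP]
    simp only [transpose_smul, hPt, Matrix.smul_mul, Matrix.mul_smul, trace_smul, smul_eq_mul]
    ring
  rw [e1, e2, e3, e4, hD, hRt, hRR] at h
  rw [h, dualObjective, ← hN, hdisp]
  have := mul_le_mul_of_nonneg_right hc2 (sub_nonneg.mpr hlt.le)
  linarith

lemma exists_displacement_le (hp : 0 < p) {ρ : ℝ} (hρ : 0 < ρ) (S : Matrix (Fin p) (Fin p) ℝ)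
    {X : Matrix (Fin p) (Fin p) ℝ} (hX : X.PosDef) {v : Fin p → ℝ} (hv : v ⬝ᵥ v = 1)
    (hmax : ∀ x, x ⬝ᵥ X *ᵥ x ≤ (v ⬝ᵥ X *ᵥ v) * (x ⬝ᵥ x)) {ε : ℝ} (hε : 0 < ε) :
    ∃ γ ∈ dualFeasible X, displacement S X γ ≤ ρ ^ 2 ∧
      (ρ ^ 2 - displacement S X γ) * (γ - v ⬝ᵥ X *ᵥ v) ≤ ε := by
  set l := v ⬝ᵥ X *ᵥ v
  have hfeas {γ : ℝ} (h : l < γ) : γ ∈ dualFeasible X := by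
    simpa [dualFeasible] using posDef_smul_one_sub_smul hX hmax zero_le_one (by simpa using h)
  by_cases hcase : ∃ γ ∈ dualFeasible X, ρ ^ 2 ≤ displacement S X γ
  · obtain ⟨γ₁, hγ₁, hge⟩ := hcase
    have hγ₁0 := dualFeasible_pos hp hX hγ₁
    have hl₁ : l < γ₁ := lt_of_mem_dualFeasible hv hγ₁
    -- With `t = 1/γ`, the limit `γ → ∞` becomes the endpoint `t = 0`, where the displacement
    -- vanishes, so the intermediate value theorem applies.
    let B : ℝ → Matrix (Fin p) (Fin p) ℝ := fun t => (1 - t • X)⁻¹ * CFC.sqrt S - CFC.sqrt S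
    let f : ℝ → ℝ := fun t => ((B t)ᵀ * B t).trace
    have hf {t : ℝ} (ht : t ≠ 0) : f t = displacement S X t⁻¹ := by
      have : t⁻¹ • (t⁻¹ • (1 : Matrix (Fin p) (Fin p) ℝ) - X)⁻¹ = (1 - t • X)⁻¹ := by
        have h1 : t⁻¹ • (1 : Matrix (Fin p) (Fin p) ℝ) - X = t⁻¹ • (1 - t • X) := by
          rw [smul_sub, smul_smul, inv_mul_cancel₀ ht, one_smul]
        by_cases hdet : IsUnit (1 - t • X).det
        · rw [h1]
          have := invertibleOfNonzero (inv_ne_zero ht)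
          rw [inv_smul _ _ hdet, smul_smul, mul_invOf_self, one_smul]
        -- In the singular case both inverses take the default value `0`.
        · rw [nonsing_inv_apply_not_isUnit _ hdet, nonsing_inv_apply_not_isUnit, smul_zero]
          rw [h1, det_smul]
          simpa [ht] using hdet
      simp only [f, B, displacement, ← Matrix.smul_mul, this]
    have hcont : ContinuousOn f (Set.Icc 0 γ₁⁻¹) := by
      have hinv : ContinuousOn (fun t : ℝ => (1 - t • X)⁻¹) (Set.Icc 0 γ₁⁻¹) := by
        intro t ht
        have hpd : (1 - t • X).PosDef := by
          have htl : t * l < 1 := by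
            rcases ht.1.eq_or_lt with h0 | h0
            · simp [← h0]
            · calc t * l < t * γ₁ := by gcongr
                _ ≤ γ₁⁻¹ * γ₁ := by gcongr; exact ht.2
                _ = 1 := inv_mul_cancel₀ hγ₁0.ne'
          simpa using posDef_smul_one_sub_smul (a := 1) hX hmax ht.1 htl
        have hdet : (1 - t • X).det ≠ 0 := hpd.det_pos.ne'
        have hc : Continuous fun t : ℝ => 1 - t • X := by fun_prop
        simp only [inv_def, Ring.inverse_eq_inv']
        exact ((hc.matrix_det.continuousAt.inv₀ hdet).smul
          hc.matrix_adjugate.continuousAt).continuousWithinAt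
      have hB : ContinuousOn B (Set.Icc 0 γ₁⁻¹) :=
        (hinv.mul continuousOn_const).sub continuousOn_const
      exact (continuous_id.matrix_trace).comp_continuousOn
        (((continuous_id.matrix_transpose).comp_continuousOn hB).mul hB)
    have hf0 : f 0 = 0 := by simp [f, B]
    have hf1 : f γ₁⁻¹ = displacement S X γ₁ := by rw [hf (inv_ne_zero hγ₁0.ne'), inv_inv]
    obtain ⟨t, ht, hft⟩ := intermediate_value_Icc (inv_nonneg.mpr hγ₁0.le) hcont
      (show ρ ^ 2 ∈ Set.Icc (f 0) (f γ₁⁻¹) by rw [hf0, hf1]; exact ⟨by positivity, hge⟩)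
    have ht0 : t ≠ 0 := by
      rintro rfl
      rw [hf0] at hft
      exact (pow_pos hρ 2).ne hft
    have htpos : 0 < t := ht.1.lt_of_ne ht0.symm
    rw [hf ht0] at hft
    have hγt : γ₁ ≤ t⁻¹ := (le_inv_comm₀ htpos hγ₁0).mp ht.2
    refine ⟨t⁻¹, hfeas (hl₁.trans_le hγt), hft.le, ?_⟩
    rw [hft, sub_self, zero_mul]
    exact hε.le
  -- Hard case: the budget is never reached, so `γ` is taken within `ε / ρ²` of the top eigenvalue.
  · push Not at hcase
    have hρ2 : 0 < ρ ^ 2 := by positivity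
    have hγ : l + ε / ρ ^ 2 ∈ dualFeasible X := hfeas (by linarith [div_pos hε hρ2])
    refine ⟨_, hγ, (hcase _ hγ).le, ?_⟩
    have h0 : 0 ≤ displacement S X (l + ε / ρ ^ 2) := trace_transpose_mul_self_nonneg _
    calc _ ≤ ρ ^ 2 * (ε / ρ ^ 2) := by
          rw [add_sub_cancel_left]
          gcongr
          linarith
      _ = ε := by field_simp

end StrongDuality

/-! ### Continuity of the matrix maximum -/

section Continuity

open scoped MatrixOrder

variable {p : ℕ}

lemma isCompact_frobenius_ball (ρ : ℝ) :
    IsCompact {D : Matrix (Fin p) (Fin p) ℝ | (Dᵀ * D).trace ≤ ρ ^ 2} := by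
  have hcont : Continuous fun D : Matrix (Fin p) (Fin p) ℝ => (Dᵀ * D).trace := by fun_prop
  refine IsCompact.of_isClosed_subset
    (isCompact_univ_pi fun _ => isCompact_univ_pi fun _ => isCompact_Icc (a := -|ρ|) (b := |ρ|))
    (isClosed_le hcont continuous_const) fun D hD i _ j _ => ?_
  have hD' : (Dᵀ * D).trace ≤ ρ ^ 2 := hD
  simp only [Matrix.trace, diag_apply, mul_apply, transpose_apply] at hD'
  refine abs_le.mp (sq_le_sq.mp ?_)
  calc D i j ^ 2 = D i j * D i j := sq _
    _ ≤ ∑ k, D k j * D k j :=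
      Finset.single_le_sum (f := fun k => D k j * D k j) (fun k _ => mul_self_nonneg _)
        (Finset.mem_univ i)
    _ ≤ ∑ m, ∑ k, D k m * D k m :=
      Finset.single_le_sum (f := fun m => ∑ k, D k m * D k m)
        (fun m _ => Finset.sum_nonneg fun k _ => mul_self_nonneg _) (Finset.mem_univ j)
    _ ≤ ρ ^ 2 := hD'

open scoped Matrix.Norms.L2Operator in
lemma continuousOn_matrix_sqrt :
    ContinuousOn (CFC.sqrt : Matrix (Fin p) (Fin p) ℝ → Matrix (Fin p) (Fin p) ℝ)
      {S | S.PosSemidef} :=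
  CFC.continuousOn_sqrt.mono fun _ hS => Matrix.PosSemidef.nonneg hS

/-- The values `Tr((R + D)ᵀ X (R + D))` for `‖D‖_F ≤ ρ`. -/
def perturbationValues (ρ : ℝ) (z : Matrix (Fin p) (Fin p) ℝ × Matrix (Fin p) (Fin p) ℝ) : Set ℝ :=
  (fun D => ((z.1 + D)ᵀ * z.2 * (z.1 + D)).trace) ''
    {D : Matrix (Fin p) (Fin p) ℝ | (Dᵀ * D).trace ≤ ρ ^ 2}

lemma continuous_sSup_perturbationValues (ρ : ℝ) :
    Continuous fun z : Matrix (Fin p) (Fin p) ℝ × Matrix (Fin p) (Fin p) ℝ =>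
      sSup (perturbationValues ρ z) := by
  refine IsCompact.continuous_sSup (isCompact_frobenius_ball ρ) ?_
  simp only [Function.HasUncurry.uncurry, id]
  fun_prop

end Continuity

/-! ### Assembly of the three values -/

section WorstCase

open scoped MatrixOrder

variable {p : ℕ}

lemma dualFeasible_nonempty (hp : 0 < p) {X : Matrix (Fin p) (Fin p) ℝ} (hX : X.PosDef) :
    (dualFeasible X).Nonempty := by
  obtain ⟨v, l, hv, rfl, hmax⟩ := exists_maximal_rayleigh hp X
  obtain ⟨γ, hγ, -⟩ := exists_displacement_le hp one_pos 0 hX hv hmax one_pos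
  exact ⟨γ, hγ⟩

lemma perturbationValues_subset {ρ : ℝ} (hρ : 0 < ρ) (S X : Matrix (Fin p) (Fin p) ℝ) :
    perturbationValues ρ (CFC.sqrt S, X) ⊆ expectationValues ρ S X := by
  rintro _ ⟨D, hD, rfl⟩
  exact trace_mem_expectationValues hρ S X _ (by simpa using hD)

lemma perturbationValues_nonempty (ρ : ℝ)
    (z : Matrix (Fin p) (Fin p) ℝ × Matrix (Fin p) (Fin p) ℝ) :
    (perturbationValues ρ z).Nonempty :=
  ⟨_, 0, by simpa using sq_nonneg ρ, rfl⟩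

lemma expectationValues_le_dualObjective (hp : 0 < p) {ρ : ℝ} (hρ : 0 < ρ)
    {S X : Matrix (Fin p) (Fin p) ℝ} (hS : S.PosSemidef) (hX : X.PosDef) {γ : ℝ}
    (hγ : γ ∈ dualFeasible X) : dualObjective ρ S X γ ∈ upperBounds (expectationValues ρ S X) := by
  rintro _ ⟨Q, hQ, rfl⟩
  exact integral_le_dualObjective hp hρ hS hX hQ hγ

lemma isLUB_worstCaseExpectation (hp : 0 < p) {ρ : ℝ} (hρ : 0 < ρ)
    {S X : Matrix (Fin p) (Fin p) ℝ} (hS : S.PosSemidef) (hX : X.PosDef) :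
    IsLUB (expectationValues ρ S X) (worstCaseExpectation ρ S X) := by
  obtain ⟨γ, hγ⟩ := dualFeasible_nonempty hp hX
  exact isLUB_csSup ((perturbationValues_nonempty ρ _).mono (perturbationValues_subset hρ S X))
    ⟨_, expectationValues_le_dualObjective hp hρ hS hX hγ⟩

lemma isGLB_sSup_perturbationValues (hp : 0 < p) {ρ : ℝ} (hρ : 0 < ρ)
    {S X : Matrix (Fin p) (Fin p) ℝ} (hS : S.PosSemidef) (hX : X.PosDef) :
    IsGLB (dualObjective ρ S X '' dualFeasible X)
      (sSup (perturbationValues ρ (CFC.sqrt S, X))) := by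
  have hub {γ : ℝ} (hγ : γ ∈ dualFeasible X) :
      dualObjective ρ S X γ ∈ upperBounds (perturbationValues ρ (CFC.sqrt S, X)) :=
    upperBounds_mono_set (perturbationValues_subset hρ S X)
      (expectationValues_le_dualObjective hp hρ hS hX hγ)
  refine ⟨?_, fun b hb => le_of_forall_pos_le_add fun ε hε => ?_⟩
  · rintro _ ⟨γ, hγ, rfl⟩
    exact csSup_le (perturbationValues_nonempty ρ _) (hub hγ)
  · obtain ⟨v, l, hv, rfl, hmax⟩ := exists_maximal_rayleigh hp X
    obtain ⟨γ, hγ, hle, hgap⟩ := exists_displacement_le hp hρ S hX hv hmax hε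
    obtain ⟨D, hD, hval⟩ := exists_perturbation_ge hS hX hv hγ hle
    have h1 : b ≤ dualObjective ρ S X γ := hb ⟨γ, hγ, rfl⟩
    have h2 : ((CFC.sqrt S + D)ᵀ * X * (CFC.sqrt S + D)).trace ≤
        sSup (perturbationValues ρ (CFC.sqrt S, X)) := le_csSup ⟨_, hub hγ⟩ ⟨D, hD, rfl⟩
    linarith

/-- `g` is squeezed between the matrix supremum and the dual infimum, which coincide. -/
lemma worstCaseExpectation_eq_sSup (hp : 0 < p) {ρ : ℝ} (hρ : 0 < ρ)
    {S X : Matrix (Fin p) (Fin p) ℝ} (hS : S.PosSemidef) (hX : X.PosDef) :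
    worstCaseExpectation ρ S X = sSup (perturbationValues ρ (CFC.sqrt S, X)) := by
  have hLUB := isLUB_worstCaseExpectation hp hρ hS hX
  refine le_antisymm ((isGLB_sSup_perturbationValues hp hρ hS hX).2 ?_)
    (csSup_le_csSup ⟨_, hLUB.1⟩ (perturbationValues_nonempty ρ _)
      (perturbationValues_subset hρ S X))
  rintro _ ⟨γ, hγ, rfl⟩
  exact hLUB.2 (expectationValues_le_dualObjective hp hρ hS hX hγ)

lemma continuousOn_worstCaseExpectation (hp : 0 < p) {ρ : ℝ} (hρ : 0 < ρ) :
    ContinuousOn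
      (fun z : Matrix (Fin p) (Fin p) ℝ × Matrix (Fin p) (Fin p) ℝ =>
        worstCaseExpectation ρ z.1 z.2)
      {z | z.1.PosSemidef ∧ z.2.PosDef} := by
  have h : ContinuousOn (fun z : Matrix (Fin p) (Fin p) ℝ × Matrix (Fin p) (Fin p) ℝ =>
      (CFC.sqrt z.1, z.2)) {z | z.1.PosSemidef ∧ z.2.PosDef} :=
    (continuousOn_matrix_sqrt.comp continuousOn_fst fun _ hz => hz.1).prodMk continuousOn_snd
  exact ((continuous_sSup_perturbationValues ρ).comp_continuousOn h).congr
    fun z hz => worstCaseExpectation_eq_sSup hp hρ hz.1 hz.2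

end WorstCase

theorem proposition2p7 (p : ℕ) (hp : 0 < p) (ρ : ℝ) (hρ : 0 < ρ) :
    (∀ Shat X : Matrix (Fin p) (Fin p) ℝ, Shat.PosSemidef → X.PosDef →
      (∀ Q ∈ ambiguitySet ρ Shat, Integrable (quadForm X) Q) ∧
      IsLUB (expectationValues ρ Shat X) (worstCaseExpectation ρ Shat X) ∧
      IsGLB (dualObjective ρ Shat X '' dualFeasible X) (worstCaseExpectation ρ Shat X)) ∧
    ContinuousOn
      (fun z : Matrix (Fin p) (Fin p) ℝ × Matrix (Fin p) (Fin p) ℝ =>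
        worstCaseExpectation ρ z.1 z.2)
      {z | z.1.PosSemidef ∧ z.2.PosDef} := by
  refine ⟨fun S X hS hX => ⟨?_, isLUB_worstCaseExpectation hp hρ hS hX, ?_⟩,
    continuousOn_worstCaseExpectation hp hρ⟩
  · rintro _ ⟨⟨S', -, rfl⟩, -⟩
    exact integrable_quadForm X
  · rw [worstCaseExpectation_eq_sSup hp hρ hS hX]
    exact isGLB_sSup_perturbationValues hp hρ hS hX
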